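/- For integers $n, m \ge 1$ with $n \le m$ let $\Phi_{m,n} = \{(s_1,\dots,s_m) \in \mathbb{Z}_{\ge 0}^m : \sum_{j=1}^m s_j = n\}$. For a unitary matrix $U \in U(m)$ and $S \in \Phi_{m,n}$ let $U_S \in \mathbb{C}^{n\times n}$ be the matrix obtained from $U$ by discarding all but the first $n$ columns and then, for every $j \in \{1,\dots,m\}$, taking $s_j$ copies of the $j$-th row. The Boson-Sampling distribution $\mathcal{D}_U$ on $\Phi_{m,n}$ is given by $$\Pr_{\mathcal{D}_U}[S] = \frac{|\mathrm{Perm}(U_S)|^2}{\prod_{j=1}^m s_j!}.$$ Let $\mu_H$ be the normalised Haar measure on $U(m)$. **Theorem 5 (Flatness of the Boson-Sampling distribution).** Let $\nu > 3$. Then for every $m = m(n) \in \Omega(n^\nu)$, as $n \to \infty$, $$-\ln\left(\Pr_{U \sim \mu_H}\left[\exists S \in \Phi_{m,n} : \Pr_{\mathcal{D}_U}[S] \ge \mathrm{e}^{-2n}\right]\right) \in \Omega\left(n^{\nu-2-1/n}\right).$$ That is, there are a constant $C > 0$ and an $n_0$, depending only on $\nu$ and on the function $m$, such that for all $n \ge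 n_0$ the probability over $U \sim \mu_H$ that some outcome $S \in \Phi_{m,n}$ has $\Pr_{\mathcal{D}_U}[S] \ge \mathrm{e}^{-2n}$ is nonzero and at most $\exp(-C\, n^{\nu-2-1/n})$. -/

import Mathlib

open Filter Asymptotics MeasureTheory

/-- The unitary group `U(m)`, with the subspace topology of the space of `m × m` matrices. -/
abbrev UMat (m : ℕ) : Type := Matrix.unitaryGroup (Fin m) ℂ

instance instCompactSpaceUMat (m : ℕ) : CompactSpace (UMat m) := by
  refine isCompact_iff_compactSpace.mp ?_
  have hK : IsCompact ((Set.univ : Set (Fin m)).pi fun _ =>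
      (Set.univ : Set (Fin m)).pi fun _ => Metric.closedBall (0 : ℂ) 1) :=
    isCompact_univ_pi fun _ => isCompact_univ_pi fun _ => isCompact_closedBall 0 1
  refine IsCompact.of_isClosed_subset (X := Fin m → Fin m → ℂ) hK ?_ ?_
  · exact isClosed_unitary (R := Matrix (Fin m) (Fin m) ℂ)
  · intro U hU i _ j _
    rw [mem_closedBall_zero_iff]
    exact entry_norm_bound_of_unitary hU i j

/-- The Borel `σ`-algebra on `U(m)`. -/
noncomputable instance instMeasurableSpaceUMat (m : ℕ) : MeasurableSpace (UMat m) := borel (UMat m)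

instance instBorelSpaceUMat (m : ℕ) : BorelSpace (UMat m) := ⟨rfl⟩

/-- The Haar measure `μ_H` on `U(m)`, normalised so that the whole group has measure `1`. -/
noncomputable def haarU (m : ℕ) : Measure (UMat m) := Measure.haarMeasure ⊤

/-- The sample space `Φ_{m,n}`: sequences `(s_1, …, s_m)` of natural numbers with sum `n`. -/
abbrev Outcome (m n : ℕ) : Type := {s : Fin m → ℕ // ∑ j, s j = n}

namespace Outcome

variable {m n : ℕ}

/-- The `i`-th entry of the nondecreasing list of row indices in which every `j` occurs exactly
`s_j` times. -/
def row (S : Outcome m n) (i : Fin n) : Fin m :=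
  (finSigmaFinEquiv.symm (Fin.cast S.2.symm i)).1

/-- The `n × n` matrix `U_S`: keep the first `n` columns of `U` and take `s_j` copies of the `j`-th
row of what remains. -/
def subMat (h : n ≤ m) (U : UMat m) (S : Outcome m n) : Matrix (Fin n) (Fin n) ℂ :=
  (U : Matrix (Fin m) (Fin m) ℂ).submatrix S.row (Fin.castLE h)

/-- The Boson-Sampling probability `|Perm (U_S)|² / ∏ⱼ s_j!` of the outcome `S`. -/
noncomputable def prob (h : n ≤ m) (U : UMat m) (S : Outcome m n) : ℝ :=
  ‖(subMat h U S).permanent‖ ^ 2 / ∏ j, ((S.1 j).factorial : ℝ)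

end Outcome

/-- The event that the Boson-Sampling distribution of `n` bosons in `m` modes gives some outcome a
probability of at least `ε`. A device with `n` bosons needs `n ≤ m` modes, as the input state is
`(1, …, 1, 0, …, 0)` with `n` ones. -/
def peakedEvent (m n : ℕ) (ε : ℝ) : Set (UMat m) :=
  {U | ∃ h : n ≤ m, ∃ S : Outcome m n, ε ≤ S.prob h U}

/-!
The permanent of an `n × n` matrix with entries of modulus at most `r` has modulus at most
`n! * r ^ n`, so an outcome can have probability at least `exp (-2 * n)` only if some entry of `U`
has modulus at least `1 / (3 * n)`. The argument is a union bound over the `m ^ 2` entries of `U`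
(`haarU_peakedEvent_le`), based on a subgaussian tail bound for a single entry.

The tail bound needs nothing about the Haar measure but its left invariance. Take a unitary `F`
whose `i`-th row has all its entries of modulus `1 / √m`, and a diagonal matrix `D` of signs. Then
`(F * D * U) i j = ∑ k, ± F i k * U k j` has the same law as `U i j`. For fixed `U`, the average
over all choices of signs is that of a Rademacher sum whose coefficients have squared moduli with
sum `1 / m`. Hence `re (w * U i j)`, for `‖w‖ = 1`, is subgaussian with variance proxy `1 / m`
(`integral_exp_re_entry_le`), and Chernoff's bound gives
`ℙ (r ≤ ‖U i j‖) ≤ 4 * exp (-(m * r ^ 2 / 4))`.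

With `r = 1 / (3 * n)` the event has probability at most `4 * m ^ 2 * exp (-(m / (36 * n ^ 2)))`.
As `n ^ 3 = O(m)`, the exponent `m / n ^ 2` is at least of order `m ^ (1 / 3)`, which dominates the
logarithm of the number of entries; and `m / n ^ 2` is at least of order `n ^ (ν - 2)`.

The logarithm of the probability is meaningful since the event is not null: it contains a
neighbourhood of a permutation matrix for which some outcome is certain
(`haarU_peakedEvent_pos`).
-/

/-! ### Permanents and outcome probabilities -/

theorem Matrix.norm_permanent_le {n : ℕ} (A : Matrix (Fin n) (Fin n) ℂ) {r : ℝ}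
    (h : ∀ i j, ‖A i j‖ ≤ r) : ‖A.permanent‖ ≤ n.factorial * r ^ n := by
  calc ‖A.permanent‖ ≤ ∑ σ : Equiv.Perm (Fin n), ‖∏ i, A (σ i) i‖ := norm_sum_le _ _
    _ ≤ ∑ _σ : Equiv.Perm (Fin n), r ^ n := by
        refine Finset.sum_le_sum fun σ _ => ?_
        rw [norm_prod]
        simpa using Finset.prod_le_prod (s := Finset.univ) (fun i _ => norm_nonneg _)
          (fun i _ => h (σ i) i)
    _ = n.factorial * r ^ n := by simp [Fintype.card_perm]

theorem Outcome.prob_lt_of_entries_le {m n : ℕ} (hn : n ≠ 0) (h : n ≤ m) (U : UMat m)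
    (hU : ∀ i j, ‖(U : Matrix (Fin m) (Fin m) ℂ) i j‖ ≤ 1 / (3 * n)) (S : Outcome m n) :
    S.prob h U < Real.exp (-2 * n) := by
  have hn' : (0 : ℝ) < n := by positivity
  have hperm : ‖(subMat h U S).permanent‖ ≤ (1 / 3) ^ n := by
    refine (Matrix.norm_permanent_le _ fun i j => hU _ _).trans ?_
    calc (n.factorial : ℝ) * (1 / (3 * n)) ^ n ≤ (n : ℝ) ^ n * (1 / (3 * n)) ^ n := by
          gcongr
          exact_mod_cast Nat.factorial_le_pow n
      _ = (1 / 3) ^ n := by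
          rw [← mul_pow]
          congr 1
          field_simp
  have hfac : (1 : ℝ) ≤ ∏ j, ((S.1 j).factorial : ℝ) := by
    rw [← Nat.cast_prod]
    exact_mod_cast Nat.one_le_iff_ne_zero.mpr
      (Finset.prod_ne_zero_iff.mpr fun j _ => Nat.factorial_ne_zero _)
  calc S.prob h U ≤ ‖(subMat h U S).permanent‖ ^ 2 := div_le_self (by positivity) hfac
    _ ≤ ((1 / 3) ^ n) ^ 2 := by gcongr
    _ < (Real.exp (-1) ^ n) ^ 2 := by
        gcongr
        rw [Real.exp_neg, one_div]
        gcongr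
        exact Real.exp_one_lt_three
    _ = Real.exp (-2 * n) := by
        rw [← pow_mul, ← Real.exp_nat_mul]
        congr 1
        push_cast
        ring

/-! ### Rademacher sums, flat rows and sign matrices -/

/-- The moment generating function of a Rademacher sum is at most that of a centred Gaussian of the
same variance. -/
theorem sum_exp_sum_sign_mul_le {ι : Type*} [Fintype ι] [DecidableEq ι] (x : ι → ℝ) :
    ∑ ε : ι → ℤˣ, Real.exp (∑ k, ((ε k : ℤ) : ℝ) * x k) ≤
      2 ^ Fintype.card ι * Real.exp ((∑ k, x k ^ 2) / 2) := by
  calc ∑ ε : ι → ℤˣ, Real.exp (∑ k, ((ε k : ℤ) : ℝ) * x k)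
      = ∏ k, ∑ e : ℤˣ, Real.exp (((e : ℤ) : ℝ) * x k) := by
        simp_rw [Real.exp_sum, Finset.prod_univ_sum, Fintype.piFinset_univ]
    _ ≤ ∏ k, 2 * Real.exp (x k ^ 2 / 2) := by
        refine Finset.prod_le_prod (fun k _ => by positivity) fun k _ => ?_
        have h := Real.cosh_le_exp_half_sq (x k)
        rw [Real.cosh_eq] at h
        simp only [UnitsInt.univ, Finset.sum_insert, Finset.sum_singleton, Finset.mem_singleton,
          show (1 : ℤˣ) ≠ -1 by decide, not_false_eq_true, Units.val_one, Int.cast_one, one_mul,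
          Units.val_neg, Int.cast_neg, neg_mul]
        linarith
    _ = 2 ^ Fintype.card ι * Real.exp ((∑ k, x k ^ 2) / 2) := by
        rw [Finset.prod_mul_distrib, ← Real.exp_sum, Finset.sum_div]
        simp

/-- The constant unit vector extends to an orthonormal basis. -/
theorem Matrix.exists_unitary_flat_row {m : ℕ} (i : Fin m) :
    ∃ F : UMat m, ∀ k, ‖(F : Matrix (Fin m) (Fin m) ℂ) i k‖ ^ 2 = 1 / m := by
  have hm : (0 : ℝ) < m := by exact_mod_cast i.pos
  let v : Fin m → EuclideanSpace ℂ (Fin m) :=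
    fun _ => WithLp.toLp 2 fun _ => ((1 / √m : ℝ) : ℂ)
  have hv : Orthonormal ℂ (({i} : Set (Fin m)).domRestrict v) := by
    refine ⟨fun a => ?_, fun a b hab => (hab (Subsingleton.elim a b)).elim⟩
    have : ‖v a‖ ^ 2 = 1 := by
      rw [EuclideanSpace.norm_sq_eq]
      simp [v, hm.ne']
    exact (pow_eq_one_iff_of_nonneg (norm_nonneg _) two_ne_zero).mp this
  obtain ⟨b, hb⟩ := hv.exists_orthonormalBasis_extension_of_card_eq (by simp)
  refine ⟨⟨Matrix.of fun j k => b j k, ?_⟩, fun k => ?_⟩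
  · rw [Matrix.mem_unitaryGroup_iff]
    ext j k
    have := orthonormal_iff_ite.mp b.orthonormal k j
    simp only [PiLp.inner_apply, RCLike.inner_apply] at this
    simp [Matrix.mul_apply, Matrix.star_apply, Matrix.one_apply, this, eq_comm]
  · have : b i k = ((1 / √m : ℝ) : ℂ) := by rw [hb i rfl]
    simp only [Matrix.of_apply, this, Complex.norm_real, Real.norm_eq_abs, sq_abs, div_pow,
      one_pow, Real.sq_sqrt hm.le]

/-- The unitary diagonal matrix with the signs `ε k` on its diagonal. -/
def signDiagonal {m : ℕ} (ε : Fin m → ℤˣ) : UMat m :=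
  ⟨Matrix.diagonal fun k => ((ε k : ℤ) : ℂ), by
    rw [Matrix.mem_unitaryGroup_iff, Matrix.star_eq_conjTranspose, Matrix.diagonal_conjTranspose,
      Matrix.diagonal_mul_diagonal, ← Matrix.diagonal_one]
    congr 1
    ext k
    rcases Int.units_eq_one_or (ε k) with h | h <;> simp [h]⟩

/-! ### Tail bounds for the entries of a Haar unitary -/

instance (m : ℕ) : (haarU m).IsHaarMeasure := by unfold haarU; infer_instance

instance (m : ℕ) : IsProbabilityMeasure (haarU m) :=
  ⟨by
    have h := Measure.haarMeasure_self (K₀ := (⊤ : TopologicalSpace.PositiveCompacts (UMat m)))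
    simpa [haarU] using h⟩

theorem continuous_entry {m : ℕ} (i j : Fin m) :
    Continuous fun U : UMat m => (U : Matrix (Fin m) (Fin m) ℂ) i j :=
  continuous_subtype_val.matrix_elem i j

theorem sum_norm_sq_column {m : ℕ} (U : UMat m) (j : Fin m) :
    ∑ k, ‖(U : Matrix (Fin m) (Fin m) ℂ) k j‖ ^ 2 = 1 := by
  have h := congrFun (congrFun (Matrix.mem_unitaryGroup_iff'.mp U.2) j) j
  simp only [Matrix.mul_apply, Matrix.star_apply, Matrix.one_apply_eq, RCLike.star_def,
    Complex.conj_mul'] at h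
  exact_mod_cast h

/-- The real part of an entry of a Haar unitary, rotated by any phase, is subgaussian with variance
proxy `1 / m`. By left invariance `U` may be replaced by `F * signDiagonal ε * U`, with the `i`-th
row of `F` flat, and the result averaged over all `ε`. -/
theorem integral_exp_re_entry_le {m : ℕ} (i j : Fin m) {w : ℂ} (hw : ‖w‖ = 1) (s : ℝ) :
    ∫ U, Real.exp (s * (w * (U : Matrix (Fin m) (Fin m) ℂ) i j).re) ∂haarU m ≤
      Real.exp (s ^ 2 / (2 * m)) := by
  obtain ⟨F, hF⟩ := Matrix.exists_unitary_flat_row i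
  set I := ∫ U, Real.exp (s * (w * (U : Matrix (Fin m) (Fin m) ℂ) i j).re) ∂haarU m with hI
  let x : UMat m → Fin m → ℝ := fun U k =>
    s * (w * ((F : Matrix (Fin m) (Fin m) ℂ) i k * (U : Matrix (Fin m) (Fin m) ℂ) k j)).re
  have hx : ∀ k, Continuous fun U => x U k := fun k =>
    continuous_const.mul (Complex.continuous_re.comp
      (continuous_const.mul (continuous_const.mul (continuous_entry k j))))
  have hcont : ∀ ε : Fin m → ℤˣ,
      Continuous fun U => Real.exp (∑ k, ((ε k : ℤ) : ℝ) * x U k) := fun ε =>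
    Real.continuous_exp.comp (continuous_finsetSum _ fun k _ => continuous_const.mul (hx k))
  have hint : ∀ ε : Fin m → ℤˣ,
      Integrable (fun U => Real.exp (∑ k, ((ε k : ℤ) : ℝ) * x U k)) (haarU m) := fun ε =>
    (hcont ε).integrable_of_hasCompactSupport (HasCompactSupport.of_compactSpace _)
  have hshift : ∀ ε : Fin m → ℤˣ,
      ∫ U, Real.exp (∑ k, ((ε k : ℤ) : ℝ) * x U k) ∂haarU m = I := fun ε => by
    rw [hI, ← integral_mul_left_eq_self
      (fun U : UMat m => Real.exp (s * (w * (U : Matrix (Fin m) (Fin m) ℂ) i j).re))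
      (F * signDiagonal ε)]
    refine integral_congr_ae (ae_of_all _ fun U => ?_)
    have hmul : ((F * signDiagonal ε * U : UMat m) : Matrix (Fin m) (Fin m) ℂ) i j =
        ∑ k, (F : Matrix (Fin m) (Fin m) ℂ) i k * ((ε k : ℤ) : ℂ) *
          (U : Matrix (Fin m) (Fin m) ℂ) k j := by
      rw [Submonoid.coe_mul, Submonoid.coe_mul, Matrix.mul_apply]
      simp only [signDiagonal, Matrix.mul_diagonal]
    beta_reduce
    rw [hmul, Finset.mul_sum, Complex.re_sum, Finset.mul_sum]
    congr 1
    refine Finset.sum_congr rfl fun k _ => ?_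
    rcases Int.units_eq_one_or (ε k) with h | h
    · simp [h, x]
    · simp [h, x]
      ring
  have hsq : ∀ U, ∑ k, x U k ^ 2 ≤ s ^ 2 / m := fun U => by
    calc ∑ k, x U k ^ 2
        ≤ ∑ k, s ^ 2 * (1 / m * ‖(U : Matrix (Fin m) (Fin m) ℂ) k j‖ ^ 2) := by
          refine Finset.sum_le_sum fun k _ => ?_
          rw [← hF k, ← mul_pow, ← norm_mul, mul_pow]
          gcongr s ^ 2 * ?_
          rw [← one_mul ‖_‖, ← hw, ← norm_mul, ← sq_abs]
          gcongr
          exact Complex.abs_re_le_norm _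
      _ = s ^ 2 / m := by
          rw [← Finset.mul_sum, ← Finset.mul_sum, sum_norm_sq_column]
          ring
  have hcard : (Fintype.card (Fin m → ℤˣ) : ℝ) = 2 ^ m := by
    simp [Fintype.card_units_int]
  have key : 2 ^ m * I ≤ 2 ^ m * Real.exp (s ^ 2 / (2 * m)) := by
    calc 2 ^ m * I = ∑ ε : Fin m → ℤˣ, ∫ U, Real.exp (∑ k, ((ε k : ℤ) : ℝ) * x U k) ∂haarU m := by
          simp_rw [hshift]
          rw [Finset.sum_const, Finset.card_univ, nsmul_eq_mul, hcard]
      _ = ∫ U, ∑ ε : Fin m → ℤˣ, Real.exp (∑ k, ((ε k : ℤ) : ℝ) * x U k) ∂haarU m :=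
          (integral_finsetSum _ fun ε _ => hint ε).symm
      _ ≤ ∫ _U, 2 ^ m * Real.exp (s ^ 2 / (2 * m)) ∂haarU m := by
          refine integral_mono (integrable_finsetSum _ fun ε _ => hint ε)
            (integrable_const _) fun U => ?_
          refine (sum_exp_sum_sign_mul_le (x U)).trans ?_
          rw [Fintype.card_fin]
          gcongr 2 ^ m * Real.exp ?_
          rw [mul_comm (2 : ℝ), ← div_div]
          exact div_le_div_of_nonneg_right (hsq U) two_pos.le
      _ = 2 ^ m * Real.exp (s ^ 2 / (2 * m)) := by simp
  exact le_of_mul_le_mul_left key (by positivity)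

theorem haarU_le_re_entry_le {m : ℕ} (i j : Fin m) {w : ℂ} (hw : ‖w‖ = 1) {r : ℝ} (hr : 0 ≤ r) :
    (haarU m).real {U | r ≤ (w * (U : Matrix (Fin m) (Fin m) ℂ) i j).re} ≤
      Real.exp (-(m * r ^ 2 / 2)) := by
  have hm : (0 : ℝ) < m := by exact_mod_cast i.pos
  have hcont : Continuous fun U : UMat m => (w * (U : Matrix (Fin m) (Fin m) ℂ) i j).re :=
    Complex.continuous_re.comp (continuous_const.mul (continuous_entry i j))
  -- The exponent `-s r + s² / (2 m)` of the Chernoff bound is smallest at `s = m r`.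
  refine (ProbabilityTheory.measure_ge_le_exp_mul_mgf (t := m * r) r (by positivity)
    ((Real.continuous_exp.comp (continuous_const.mul hcont)).integrable_of_hasCompactSupport
      (HasCompactSupport.of_compactSpace _))).trans ?_
  refine (mul_le_mul_of_nonneg_left (integral_exp_re_entry_le i j hw (m * r))
    (Real.exp_nonneg _)).trans_eq ?_
  rw [← Real.exp_add]
  congr 1
  field_simp
  ring

/-- A number of modulus at least `r` has real or imaginary part at least `r / √2` in absolute
value; this accounts for the four phases `±1`, `±I`, hence for the factor `4`. -/
theorem haarU_le_norm_entry_le {m : ℕ} (i j : Fin m) {r : ℝ} (hr : 0 ≤ r) :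
    (haarU m).real {U | r ≤ ‖(U : Matrix (Fin m) (Fin m) ℂ) i j‖} ≤
      4 * Real.exp (-(m * r ^ 2 / 4)) := by
  let E : ℂ → Set (UMat m) := fun w =>
    {U | r / √2 ≤ (w * (U : Matrix (Fin m) (Fin m) ℂ) i j).re}
  have hE : ∀ w : ℂ, ‖w‖ = 1 → (haarU m).real (E w) ≤ Real.exp (-(m * r ^ 2 / 4)) := fun w hw => by
    refine (haarU_le_re_entry_le i j hw (r := r / √2) (by positivity)).trans_eq ?_
    rw [div_pow, Real.sq_sqrt (by norm_num)]
    congr 1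
    ring
  have hsub : {U : UMat m | r ≤ ‖(U : Matrix (Fin m) (Fin m) ℂ) i j‖} ⊆
      (E 1 ∪ E (-1)) ∪ (E Complex.I ∪ E (-Complex.I)) := fun U hU => by
    by_contra hcon
    simp only [E, Set.mem_union, Set.mem_ofPred_eq, not_or, not_le, one_mul, neg_mul,
      Complex.neg_re, Complex.I_mul_re, neg_neg] at hcon hU
    obtain ⟨⟨h1, h2⟩, h3, h4⟩ := hcon
    have hre := sq_lt_sq' (by linarith) h1
    have him := sq_lt_sq' (by linarith) h4
    have hnorm := Complex.sq_norm ((U : Matrix (Fin m) (Fin m) ℂ) i j)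
    rw [Complex.normSq_apply] at hnorm
    have hle := pow_le_pow_left₀ hr hU 2
    rw [div_pow, Real.sq_sqrt (by norm_num)] at hre him
    linarith
  have h₁ := measureReal_union_le (μ := haarU m) (E 1) (E (-1))
  have h₂ := measureReal_union_le (μ := haarU m) (E Complex.I) (E (-Complex.I))
  have h₃ := measureReal_union_le (μ := haarU m) (E 1 ∪ E (-1)) (E Complex.I ∪ E (-Complex.I))
  linarith [measureReal_mono (μ := haarU m) hsub, hE 1 (by simp), hE (-1) (by simp),
    hE Complex.I (by simp), hE (-Complex.I) (by simp)]

/-! ### Probability of the peaked event -/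

theorem haarU_peakedEvent_le (m : ℕ) {n : ℕ} (hn : n ≠ 0) :
    (haarU m).real (peakedEvent m n (Real.exp (-2 * n))) ≤
      4 * m ^ 2 * Real.exp (-(m / (36 * n ^ 2))) := by
  have hsub : peakedEvent m n (Real.exp (-2 * n)) ⊆
      ⋃ p : Fin m × Fin m, {U | 1 / (3 * n : ℝ) ≤ ‖(U : Matrix (Fin m) (Fin m) ℂ) p.1 p.2‖} := by
    rintro U ⟨h, S, hS⟩
    by_contra hcon
    simp only [Set.mem_iUnion, Set.mem_ofPred_eq, not_exists, not_le] at hcon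
    exact hS.not_gt (Outcome.prob_lt_of_entries_le hn h U (fun i j => (hcon (i, j)).le) S)
  calc (haarU m).real (peakedEvent m n (Real.exp (-2 * n)))
      ≤ ∑ p : Fin m × Fin m,
          (haarU m).real {U | 1 / (3 * n : ℝ) ≤ ‖(U : Matrix (Fin m) (Fin m) ℂ) p.1 p.2‖} :=
        (measureReal_mono hsub).trans (measureReal_iUnion_fintype_le _)
    _ ≤ ∑ _p : Fin m × Fin m, 4 * Real.exp (-(m * (1 / (3 * n)) ^ 2 / 4)) :=
        Finset.sum_le_sum fun p _ => haarU_le_norm_entry_le p.1 p.2 (by positivity)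
    _ = 4 * m ^ 2 * Real.exp (-(m / (36 * n ^ 2))) := by
        have : (m * (1 / (3 * n)) ^ 2 / 4 : ℝ) = m / (36 * n ^ 2) := by
          field_simp
          ring
        rw [this, Finset.sum_const, Finset.card_univ, nsmul_eq_mul, Fintype.card_prod,
          Fintype.card_fin]
        push_cast
        ring

/-- In an outcome without collisions no row is repeated. -/
theorem Outcome.row_injective {m n : ℕ} (S : Outcome m n) (hS : ∀ j, S.1 j ≤ 1) :
    Function.Injective S.row := by
  have hfst : Function.Injective (Sigma.fst : (Σ j, Fin (S.1 j)) → Fin m) := by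
    rintro ⟨j, a⟩ ⟨k, b⟩ (rfl : j = k)
    have : Subsingleton (Fin (S.1 j)) := Fin.subsingleton_iff_le_one.mpr (hS j)
    rw [Subsingleton.elim a b]
  exact hfst.comp (finSigmaFinEquiv.symm.injective.comp (Fin.cast_injective _))

theorem Outcome.continuous_prob {m n : ℕ} (h : n ≤ m) (S : Outcome m n) :
    Continuous fun U => S.prob h U := by
  have : Continuous fun U : UMat m => (subMat h U S).permanent :=
    continuous_finsetSum _ fun σ _ => continuous_finsetProd _ fun i _ => continuous_entry _ _
  exact (this.norm.pow 2).div_const _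

/-- A permutation matrix sends the input state to a collision-free outcome with certainty. -/
theorem Outcome.exists_prob_eq_one {m n : ℕ} (h : n ≤ m) :
    ∃ (S : Outcome m n) (U : UMat m), S.prob h U = 1 := by
  let S : Outcome m n := ⟨fun j => if (j : ℕ) < n then 1 else 0, by
    rw [Finset.sum_boole, Fin.card_filter_val_lt, Nat.cast_id, min_eq_right h]⟩
  have hS : ∀ j, S.1 j ≤ 1 := fun j => by
    change (if (j : ℕ) < n then 1 else 0) ≤ 1
    split_ifs <;> simp
  obtain ⟨π, hπ⟩ := Equiv.Perm.exists_extending_pair _ _ (Fin.castLE_injective h)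
    (S.row_injective hS)
  -- The columns of the identity are permuted so that `subMat` picks out the `n × n` identity.
  let A : Matrix (Fin m) (Fin m) ℂ := (1 : Matrix (Fin m) (Fin m) ℂ).submatrix id π
  have hA : A ∈ Matrix.unitaryGroup (Fin m) ℂ := by
    rw [Matrix.mem_unitaryGroup_iff, Matrix.star_eq_conjTranspose, Matrix.conjTranspose_submatrix,
      Matrix.submatrix_mul_equiv]
    simp
  refine ⟨S, ⟨A, hA⟩, ?_⟩
  have hsub : subMat h ⟨A, hA⟩ S = 1 := by
    ext i j
    simp [subMat, A, hπ, Matrix.one_apply, (S.row_injective hS).eq_iff]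
  have hfac : ∀ j, (S.1 j).factorial = 1 := fun j => Nat.factorial_eq_one.mpr (hS j)
  simp [prob, hsub, hfac]

theorem haarU_peakedEvent_pos {m n : ℕ} (hn : n ≠ 0) (h : n ≤ m) :
    0 < (haarU m).real (peakedEvent m n (Real.exp (-2 * n))) := by
  obtain ⟨S, U, hU⟩ := Outcome.exists_prob_eq_one h
  have hopen : IsOpen {V | Real.exp (-2 * n) < S.prob h V} :=
    isOpen_lt continuous_const (S.continuous_prob h)
  have hmem : U ∈ {V | Real.exp (-2 * n) < S.prob h V} := by
    rw [Set.mem_ofPred_eq, hU, Real.exp_lt_one_iff]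
    have : (0 : ℝ) < n := by positivity
    linarith
  have hsub : {V | Real.exp (-2 * n) < S.prob h V} ⊆ peakedEvent m n (Real.exp (-2 * n)) :=
    fun V hV => ⟨h, S, le_of_lt hV⟩
  exact ENNReal.toReal_pos ((hopen.measure_pos (haarU m) ⟨U, hmem⟩).trans_le
    (measure_mono hsub)).ne' (measure_ne_top _ _)

/-! ### Asymptotics -/

theorem eventually_log_le_rpow {a : ℝ} (ha : 0 < a) :
    ∀ᶠ x : ℝ in atTop, Real.log (4 * x ^ 2) ≤ a * x ^ (1 / 3 : ℝ) := by
  have h := (isLittleO_log_rpow_atTop (r := 1 / 3) (by norm_num)).bound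
    (show 0 < a / 4 by positivity)
  filter_upwards [h, eventually_ge_atTop 2] with x hx hx2
  have hlog : 0 ≤ Real.log x := Real.log_nonneg (by linarith)
  rw [Real.norm_of_nonneg hlog, Real.norm_of_nonneg (by positivity)] at hx
  calc Real.log (4 * x ^ 2) ≤ Real.log (x ^ 4) := by
        refine Real.log_le_log (by positivity) ?_
        have : 4 ≤ x ^ 2 := by nlinarith
        nlinarith
    _ = 4 * Real.log x := by simp
    _ ≤ a * x ^ (1 / 3 : ℝ) := by linarith

theorem theorem5 (ν : ℝ) (hν : 3 < ν) (m : ℕ → ℕ)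
    (hm : (fun n : ℕ => (n : ℝ) ^ ν) =O[atTop] (fun n : ℕ => (m n : ℝ))) :
    (fun n : ℕ => (n : ℝ) ^ (ν - 2 - 1 / (n : ℝ))) =O[atTop]
      (fun n : ℕ => -Real.log ((haarU (m n)).real
        (peakedEvent (m n) n (Real.exp (-2 * (n : ℝ)))))) := by
  obtain ⟨K, hK, hm⟩ := hm.exists_pos
  have hm' : ∀ᶠ n : ℕ in atTop, (n : ℝ) ^ ν ≤ K * m n := by
    filter_upwards [hm.bound] with n hn
    rwa [Real.norm_of_nonneg (by positivity), Real.norm_of_nonneg (by positivity)] at hn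
  have hmtop : Tendsto (fun n => (m n : ℝ)) atTop atTop := by
    have h := tendsto_atTop_mono' _ hm'
      ((tendsto_rpow_atTop (by linarith : 0 < ν)).comp tendsto_natCast_atTop_atTop)
    exact (tendsto_const_mul_atTop_of_pos hK).mp h
  have hlog := hmtop.eventually
    (eventually_log_le_rpow (a := 1 / (72 * K ^ (2 / 3 : ℝ))) (by positivity))
  refine IsBigO.of_bound (72 * K) ?_
  filter_upwards [hm', hlog, hmtop.eventually_ge_atTop 1, eventually_ge_atTop 1,
    tendsto_natCast_atTop_atTop.eventually_ge_atTop K] with n hmn hlogn hm1 hn1 hnK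
  have hn0 : n ≠ 0 := by lia
  have hnR : (1 : ℝ) ≤ n := by exact_mod_cast hn1
  have hM : (0 : ℝ) < m n := by linarith
  have hcube : (n : ℝ) ^ 3 ≤ K * m n := by
    refine le_trans ?_ hmn
    rw [← Real.rpow_natCast]
    exact Real.rpow_le_rpow_of_exponent_le hnR (by push_cast; linarith)
  -- `n * n ≤ n ^ 3 ≤ K * m n ≤ n * m n` once `K ≤ n`.
  have hnm : n ≤ m n := by
    have : (n : ℝ) * n ≤ n * m n := by
      calc (n : ℝ) * n ≤ K * m n := by nlinarith
        _ ≤ n * m n := by gcongr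
    exact_mod_cast le_of_mul_le_mul_left this (by linarith)
  set P := (haarU (m n)).real (peakedEvent (m n) n (Real.exp (-2 * (n : ℝ))))
  have hPpos : 0 < P := haarU_peakedEvent_pos hn0 hnm
  have hlogP : Real.log P ≤ Real.log (4 * m n ^ 2) - m n / (36 * n ^ 2) := by
    refine (Real.log_le_log hPpos (haarU_peakedEvent_le (m n) hn0)).trans_eq ?_
    rw [Real.log_mul (by positivity) (by positivity), Real.log_exp]
    ring
  -- This puts `m n / n ^ 2` above a multiple of `m n ^ (1 / 3)`, hence above `log (4 * m n ^ 2)`.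
  have hsq : (n : ℝ) ^ 2 ≤ K ^ (2 / 3 : ℝ) * (m n : ℝ) ^ (2 / 3 : ℝ) := by
    rw [← Real.mul_rpow hK.le hM.le]
    calc (n : ℝ) ^ 2 = ((n : ℝ) ^ 3) ^ (2 / 3 : ℝ) := by
          rw [← Real.rpow_natCast_mul (by positivity), ← Real.rpow_natCast]
          norm_num
      _ ≤ (K * m n) ^ (2 / 3 : ℝ) := by gcongr
  have hthird : 1 / (72 * K ^ (2 / 3 : ℝ)) * (m n : ℝ) ^ (1 / 3 : ℝ) ≤ m n / (72 * n ^ 2) := by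
    have hsplit : (m n : ℝ) = (m n : ℝ) ^ (1 / 3 : ℝ) * (m n : ℝ) ^ (2 / 3 : ℝ) := by
      rw [← Real.rpow_add hM]
      norm_num
    rw [one_div_mul_eq_div, div_le_div_iff₀ (by positivity) (by positivity)]
    calc (m n : ℝ) ^ (1 / 3 : ℝ) * (72 * n ^ 2)
        ≤ (m n : ℝ) ^ (1 / 3 : ℝ) * (72 * (K ^ (2 / 3 : ℝ) * (m n : ℝ) ^ (2 / 3 : ℝ))) := by gcongr
      _ = (m n : ℝ) ^ (1 / 3 : ℝ) * (m n : ℝ) ^ (2 / 3 : ℝ) * (72 * K ^ (2 / 3 : ℝ)) := by ring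
      _ = m n * (72 * K ^ (2 / 3 : ℝ)) := by rw [← hsplit]
  have hmain : (m n : ℝ) / (72 * n ^ 2) ≤ -Real.log P := by
    have : (m n : ℝ) / (36 * n ^ 2) = 2 * (m n / (72 * n ^ 2)) := by
      field_simp
      norm_num
    linarith
  rw [Real.norm_of_nonneg (by positivity),
    Real.norm_of_nonneg (le_trans (by positivity) hmain)]
  calc (n : ℝ) ^ (ν - 2 - 1 / (n : ℝ)) ≤ (n : ℝ) ^ (ν - (2 : ℕ)) := by
        refine Real.rpow_le_rpow_of_exponent_le hnR ?_
        have : 0 ≤ 1 / (n : ℝ) := by positivity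
        push_cast
        linarith
    _ = (n : ℝ) ^ ν / n ^ 2 := Real.rpow_sub_natCast (by positivity) _ _
    _ ≤ K * m n / n ^ 2 := by gcongr
    _ = 72 * K * (m n / (72 * n ^ 2)) := by field_simp
    _ ≤ 72 * K * -Real.log P := by gcongr
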